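/- **Proposition 7.1.** Let $X$ be a complex manifold and let $$0\to S\xrightarrow{\ j\ }E\xrightarrow{\ g\ }Q\to 0$$ be a short exact sequence of Hermitian holomorphic vector bundles of finite rank over $X$, where $S$ and $Q$ carry the metrics induced by the Hermitian metric of $E$: the map $j$ is isometric onto its image, and $g$ is isometric on the orthogonal complement of its kernel. For a Hermitian holomorphic vector bundle $G\to X$ let $\Theta_G$ be the curvature of its Chern connection. At a point $x$ write $$\tfrac{i}{2\pi}\Theta_G=i\sum_{j,k}A_{jk}\otimes e_j\otimes e_k^*$$ for an orthonormal basis $(e_j)$ of $G_x$ with dual basis $(e_j^*)$, where the $A_{jk}$ are $(1,1)$-covectors at $x$. Let $a_x$ be the Hermitian form on $T^{1,0}_xX\otimes G_x^*$ given by $$a_x(\xi\otimes e_j^*,\ \eta\otimes e_k^*)=A_{jk}(\xi,\bar\eta).$$ The bundle $G$ is called Bott–Chern positive, $G\ge_B 0$, if $a_x$ is positive semidefinite at every $x\in X$. If $E\ge_B 0$, then $Q\ge_B 0$. -/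

import Mathlib

open scoped Manifold ContDiff InnerProductSpace ComplexOrder TensorProduct

namespace BottChern

noncomputable section

/-! ### Connection and curvature forms in a local holomorphic frame

`V` is the complex coordinate space. A complex valued form on an open subset of `V` is a function of
a point and of real tangent vectors, and `fderiv ℝ` is the real differential `d`. -/

section Local

variable {V : Type*} [NormedAddCommGroup V] [NormedSpace ℂ V]
  {ι : Type*} [Fintype ι] [DecidableEq ι]

/-- The `(1,0)`-part `∂f` of the differential of `f`, at the point `y`, on the vector `w`. -/
def del (f : V → ℂ) (y w : V) : ℂ :=
  (1 / 2 : ℂ) * (fderiv ℝ f y w - Complex.I * fderiv ℝ f y (Complex.I • w))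

/-- A matrix `θ` of one-forms, which represents the connection `D e_j = ∑ k, θ_kj ⊗ e_k` in a
holomorphic frame with Gram matrix `H i j = ⟪e_i, e_j⟫`, is the Chern connection at `y` if the
`(0,1)`-part of `D` is `∂̄` (that is, `θ` is of type `(1,0)`), and `D` is compatible with the metric:
`d⟪e_i, e_j⟫ = ⟪D e_i, e_j⟫ + ⟪e_i, D e_j⟫`. -/
structure IsChernFormAt (H : V → Matrix ι ι ℂ) (θ : V → Matrix ι ι ℂ) (y : V) : Prop where
  type_one_zero : ∀ w, θ (Complex.I • w) = Complex.I • θ w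
  metric : ∀ w i j, fderiv ℝ (fun z => H z i j) y w =
    (∑ k, star (θ w k i) * H y k j) + ∑ k, H y i k * θ w k j

/-- The connection form `θ = H⁻¹ ∂H` of the Chern connection, where `H i j = ⟪e_i, e_j⟫` is the Gram
matrix of a holomorphic frame (the inner product is linear in the second variable). -/
def chernForm (H : V → Matrix ι ι ℂ) (y w : V) : Matrix ι ι ℂ :=
  (H y)⁻¹ * Matrix.of fun i j => del (fun z => H z i j) y w

/-- The curvature `Θ = dθ + θ ∧ θ` of the connection with connection form `θ`. -/
def curvatureForm (θ : V → V → Matrix ι ι ℂ) (y v w : V) : Matrix ι ι ℂ :=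
  (Matrix.of fun i j =>
      fderiv ℝ (fun z => θ z w i j) y v - fderiv ℝ (fun z => θ z v i j) y w) +
    (θ y v * θ y w - θ y w * θ y v)

theorem del_smul_I (f : V → ℂ) (y w : V) :
    del f y (Complex.I • w) = Complex.I * del f y w := by
  have h : Complex.I • Complex.I • w = -w := by
    rw [smul_smul, Complex.I_mul_I, neg_one_smul]
  simp only [del, h, map_neg]
  linear_combination ((1 / 2 : ℂ) * fderiv ℝ f y (Complex.I • w)) * Complex.I_mul_I

theorem star_del_add (f g : V → ℂ) (y w : V) (hfg : ∀ z, g z = star (f z)) :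
    star (del g y w) + del f y w = fderiv ℝ f y w := by
  have hg : g = fun z => star (f z) := funext hfg
  have h : ∀ u, fderiv ℝ g y u = star (fderiv ℝ f y u) := by
    intro u
    rw [hg, fderiv_star]
    rfl
  simp only [del, h, star_mul', star_sub, star_star]
  have h1 : star (1 / 2 : ℂ) = 1 / 2 := by simp
  have h2 : star Complex.I = -Complex.I := Complex.conj_I
  rw [h1, h2]
  ring

/-- `H⁻¹ ∂H` is the connection form of the Chern connection. -/
theorem isChernFormAt_chernForm (H : V → Matrix ι ι ℂ) (hH : ∀ z, (H z).IsHermitian) (y : V)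
    (hy : IsUnit (H y).det) : IsChernFormAt H (chernForm H y) y := by
  have key : ∀ w, H y * chernForm H y w = Matrix.of fun i j => del (fun z => H z i j) y w := by
    intro w
    rw [chernForm, Matrix.mul_nonsing_inv_cancel_left _ _ hy]
  refine ⟨fun w => ?_, fun w i j => ?_⟩
  · rw [chernForm, chernForm, ← Matrix.mul_smul]
    congr 1
    ext i j
    simp [del_smul_I]
  · have h1 : ∑ k, H y i k * chernForm H y w k j = del (fun z => H z i j) y w := by
      rw [← Matrix.mul_apply, key]; rfl
    have h2 : ∑ k, star (chernForm H y w k i) * H y k j = star (del (fun z => H z j i) y w) := by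
      have h3 : ∑ k, H y j k * chernForm H y w k i = del (fun z => H z j i) y w := by
        rw [← Matrix.mul_apply, key]; rfl
      rw [← h3, star_sum]
      refine Finset.sum_congr rfl fun k _ => ?_
      rw [star_mul', ← (hH y).apply k j, mul_comm]
    rw [h1, h2]
    exact (star_del_add _ _ y w fun z => ((hH z).apply j i).symm).symm

/-- The Chern connection is unique. -/
theorem IsChernFormAt.eq_chernForm {H : V → Matrix ι ι ℂ} {θ : V → Matrix ι ι ℂ} {y : V}
    (hy : IsUnit (H y).det) (h : IsChernFormAt H θ y) : θ = chernForm H y := by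
  funext w
  have key : H y * θ w = Matrix.of fun i j => del (fun z => H z i j) y w := by
    ext i j
    rw [Matrix.mul_apply, Matrix.of_apply, del, h.metric, h.metric, h.type_one_zero]
    have e1 : ∑ k, star ((Complex.I • θ w) k i) * H y k j
        = -Complex.I * ∑ k, star (θ w k i) * H y k j := by
      rw [Finset.mul_sum]
      refine Finset.sum_congr rfl fun k _ => ?_
      have h2 : star Complex.I = -Complex.I := Complex.conj_I
      rw [Matrix.smul_apply, smul_eq_mul, star_mul', h2]
      ring
    have e2 : ∑ k, H y i k * (Complex.I • θ w) k j = Complex.I * ∑ k, H y i k * θ w k j := by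
      rw [Finset.mul_sum]
      refine Finset.sum_congr rfl fun k _ => ?_
      rw [Matrix.smul_apply, smul_eq_mul]
      ring
    rw [e1, e2]
    linear_combination (1 / 2 : ℂ) * ((∑ k, H y i k * θ w k j) -
      ∑ k, star (θ w k i) * H y k j) * Complex.I_mul_I
  rw [chernForm, ← key, Matrix.nonsing_inv_mul_cancel_left _ _ hy]

end Local

/-! ### Pointwise positivity -/

section Pointwise

variable {T : Type*} [AddCommGroup T] [Module ℂ T]
  {W : Type*} [NormedAddCommGroup W] [InnerProductSpace ℂ W]
  {ι : Type*} [Fintype ι]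

/-- The value `B(ξ, η̄)` of the complex bilinear extension of a two-form `B` on the `(1,0)`-vector
`ξ = (v - i J v) / 2` and the `(0,1)`-vector `η̄ = (w + i J w) / 2`. Here a complex vector space `T`
is identified with its `(1,0)`-space by `v ↦ (v - i J v) / 2`, `J` being multiplication by `i`. -/
def mixed {N : Type*} [AddCommGroup N] [Module ℂ N] (B : T → T → N) (v w : T) : N :=
  (1 / 4 : ℂ) • (B v w + B (Complex.I • v) (Complex.I • w) +
    Complex.I • (B v (Complex.I • w) - B (Complex.I • v) w))

/-- The vector `ξ_j` in `t = ∑ j, ξ_j ⊗ e_j^*`, for `t` in `T ⊗ W^*`. -/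
def coeff (e : OrthonormalBasis ι ℂ W) (j : ι) (t : T ⊗[ℂ] Module.Dual ℂ W) : T :=
  TensorProduct.rid ℂ T ((Module.Dual.eval ℂ W (e j)).lTensor T t)

/-- For an `End(W)`-valued `(1,1)`-form `A = i ∑ A_jk ⊗ e_j ⊗ e_k^*`, with `e` an orthonormal basis,
the form `a` on `T ⊗ W^*` with `a(ξ ⊗ e_j^*, η ⊗ e_k^*) = A_jk(ξ, η̄)`. -/
def bottChernForm (A : T → T → (W →ₗ[ℂ] W)) (e : OrthonormalBasis ι ℂ W)
    (s t : T ⊗[ℂ] Module.Dual ℂ W) : ℂ :=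
  ∑ j, ∑ k, -Complex.I * ⟪e j, mixed A (coeff e j s) (coeff e k t) (e k)⟫_ℂ

theorem bottChernForm_tmul [DecidableEq ι] (A : T → T → (W →ₗ[ℂ] W)) (hA : ∀ v, A 0 v = 0)
    (hA' : ∀ v, A v 0 = 0) (e : OrthonormalBasis ι ℂ W) (ξ η : T) (j k : ι) :
    bottChernForm A e (ξ ⊗ₜ e.toBasis.coord j) (η ⊗ₜ e.toBasis.coord k) =
      -Complex.I * ⟪e j, mixed A ξ η (e k)⟫_ℂ := by
  have hc : ∀ (v : T) (l m : ι),
      coeff e l (v ⊗ₜ e.toBasis.coord m) = if l = m then v else 0 := by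
    intro v l m
    have h : e.toBasis.coord m (e l) = if l = m then 1 else 0 := by
      rw [← e.coe_toBasis, Module.Basis.coord_apply, Module.Basis.repr_self, Finsupp.single_apply]
    simp only [coeff, LinearMap.lTensor_tmul, TensorProduct.rid_tmul, Module.Dual.eval_apply, h]
    split_ifs <;> simp
  have h0 : ∀ v, mixed A 0 v = 0 := fun v => by simp [mixed, hA]
  have h0' : ∀ v, mixed A v 0 = 0 := fun v => by simp [mixed, hA']
  rw [bottChernForm, Finset.sum_eq_single j, Finset.sum_eq_single k]
  · simp only [hc, if_true]
  · intro l _ hl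
    simp only [hc, if_neg hl, h0', LinearMap.zero_apply, inner_zero_right, mul_zero]
  · simp
  · intro l _ hl
    refine Finset.sum_eq_zero fun m _ => ?_
    simp only [hc, if_neg hl, h0, LinearMap.zero_apply, inner_zero_right, mul_zero]
  · simp

end Pointwise

/-! ### Hermitian holomorphic vector bundles -/

section Bundles

variable (V : Type*) [NormedAddCommGroup V] [NormedSpace ℂ V]
  {X : Type*} [TopologicalSpace X] [ChartedSpace V X]
  (F : Type*) [NormedAddCommGroup F] [NormedSpace ℂ F]
  (E : X → Type*) [TopologicalSpace (Bundle.TotalSpace F E)]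
  [∀ x, NormedAddCommGroup (E x)] [∀ x, InnerProductSpace ℂ (E x)]
  [FiberBundle F E] [VectorBundle ℂ F E]

/-- The fibrewise inner product is a Hermitian metric on the bundle: in local holomorphic
coordinates and trivializations it is smooth (in the real sense). -/
def IsSmoothMetric : Prop :=
  ∀ (x : X) (a b : F),
    ContDiffOn ℝ ∞
      (fun y : V =>
        ⟪(trivializationAt F E x).symm ((chartAt V x).symm y) a,
          (trivializationAt F E x).symm ((chartAt V x).symm y) b⟫_ℂ)
      ((chartAt V x).target ∩ (chartAt V x).symm ⁻¹' (trivializationAt F E x).baseSet)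

variable [FiniteDimensional ℂ F]

/-- The Gram matrix `⟪e_i, e_j⟫` of the holomorphic frame around `x` given by the preferred
trivialization at `x`, as a function of the preferred coordinates at `x`. -/
def gram (x : X) (y : V) : Matrix (Fin (Module.finrank ℂ F)) (Fin (Module.finrank ℂ F)) ℂ :=
  Matrix.of fun i j =>
    ⟪(trivializationAt F E x).symm ((chartAt V x).symm y) (Module.finBasis ℂ F i),
      (trivializationAt F E x).symm ((chartAt V x).symm y) (Module.finBasis ℂ F j)⟫_ℂ

/-- The frame at the point `x` itself, a basis of the fibre. -/
def frameAt (x : X) : Module.Basis (Fin (Module.finrank ℂ F)) ℂ (E x) :=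
  (Module.finBasis ℂ F).map ((trivializationAt F E x).linearEquivAt ℂ x
    (FiberBundle.mem_baseSet_trivializationAt F E x)).symm

/-- The curvature `Θ` at `x` of the Chern connection, an `End(E_x)`-valued two-form on the tangent
space. The tangent space at `x` is the model space of the chart at `x`, so that the curvature at `x`
is read off in that chart and in the trivialization at `x`. -/
def chernCurvature (x : X) (v w : TangentSpace 𝓘(ℂ, V) x) : E x →ₗ[ℂ] E x :=
  Matrix.toLin (frameAt F E x) (frameAt F E x)
    (curvatureForm (chernForm (gram V F E x)) (chartAt V x x) v w)

/-- `(i / 2π) Θ`. -/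
def normalizedCurvature (x : X) (v w : TangentSpace 𝓘(ℂ, V) x) : E x →ₗ[ℂ] E x :=
  (Complex.I / (2 * Real.pi)) • chernCurvature V F E x v w

/-- Bott–Chern positivity of a Hermitian holomorphic vector bundle: the form on
`T^{1,0}_x X ⊗ E_x^*` induced by `(i / 2π) Θ` is positive semidefinite at every point `x`. (The
inequality in `ℂ` says that the value is real and nonnegative.) -/
def IsBottChernPositive : Prop :=
  ∀ (x : X) (e : OrthonormalBasis (Fin (Module.finrank ℂ F)) ℂ (E x))
    (t : TangentSpace 𝓘(ℂ, V) x ⊗[ℂ] Module.Dual ℂ (E x)),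
    0 ≤ bottChernForm (normalizedCurvature V F E x) e t t

end Bundles

section ShortExact

variable (V : Type*) [NormedAddCommGroup V] [NormedSpace ℂ V]
  {X : Type*} [TopologicalSpace X] [ChartedSpace V X]
  (FS : Type*) [NormedAddCommGroup FS] [NormedSpace ℂ FS]
  {S : X → Type*} [TopologicalSpace (Bundle.TotalSpace FS S)]
  [∀ x, NormedAddCommGroup (S x)] [∀ x, InnerProductSpace ℂ (S x)]
  [FiberBundle FS S] [VectorBundle ℂ FS S]
  (FE : Type*) [NormedAddCommGroup FE] [NormedSpace ℂ FE]
  {E : X → Type*} [TopologicalSpace (Bundle.TotalSpace FE E)]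
  [∀ x, NormedAddCommGroup (E x)] [∀ x, InnerProductSpace ℂ (E x)]
  [FiberBundle FE E] [VectorBundle ℂ FE E]
  (FQ : Type*) [NormedAddCommGroup FQ] [NormedSpace ℂ FQ]
  {Q : X → Type*} [TopologicalSpace (Bundle.TotalSpace FQ Q)]
  [∀ x, NormedAddCommGroup (Q x)] [∀ x, InnerProductSpace ℂ (Q x)]
  [FiberBundle FQ Q] [VectorBundle ℂ FQ Q]

/-- A fibrewise linear map between holomorphic vector bundles over `X` is holomorphic, as a map
between the total spaces. -/
def IsHolomorphicMorphism (φ : ∀ x, S x →ₗ[ℂ] E x) : Prop :=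
  ContMDiff (𝓘(ℂ, V).prod 𝓘(ℂ, FS)) (𝓘(ℂ, V).prod 𝓘(ℂ, FE)) ω
    (fun p : Bundle.TotalSpace FS S =>
      (⟨p.1, φ p.1 p.2⟩ : Bundle.TotalSpace FE E))

/-- `0 → S → E → Q → 0` is a short exact sequence of Hermitian holomorphic vector bundles: the maps
are holomorphic, the sequence is exact, and `S` and `Q` carry the metrics induced by the metric of
`E`, that is, `j` is an isometry onto its image and `g` is isometric on the orthogonal complement of
its kernel. -/
structure IsHermitianShortExact (j : ∀ x, S x →ₗ[ℂ] E x) (g : ∀ x, E x →ₗ[ℂ] Q x) : Prop where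
  holomorphic_j : IsHolomorphicMorphism V FS FE j
  holomorphic_g : IsHolomorphicMorphism V FE FQ g
  injective : ∀ x, Function.Injective (j x)
  exact : ∀ x, Function.Exact (j x) (g x)
  surjective : ∀ x, Function.Surjective (g x)
  metric_sub : ∀ x (s t : S x), ⟪j x s, j x t⟫_ℂ = ⟪s, t⟫_ℂ
  metric_quotient : ∀ x, ∀ u ∈ (LinearMap.ker (g x))ᗮ, ∀ v ∈ (LinearMap.ker (g x))ᗮ,
    ⟪g x u, g x v⟫_ℂ = ⟪u, v⟫_ℂ

end ShortExact

end

end BottChern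

/-! Everything is expressed through the inverse `K = H⁻¹` of the Gram matrix of a holomorphic frame,
which is essentially the dual metric. Multiplying the (1,1)-part of the curvature matrix by `K`
gives `R = ∂̄∂K - ∂K H ∂̄K` (`mixed_curvatureForm_mul_inv`), which is sesquilinear in the two
tangent vectors. Bott–Chern positivity then says that `∑ R(ζ_a, ζ_b)_{ab} ≥ 0` for every family `ζ`
of tangent vectors indexed by the frame (`isBottChernPositive_iff`).

Inverse Gram matrices behave well under quotients: if `G` is the matrix of `g` in local frames, the
quotient metric satisfies `K' = G K G*` (`inv_gram_quotient`). As `G` is holomorphic,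
differentiating gives `R'(v, w) = G R(v, w) G* + L(v) (H - G* H' G) L(w)*` with `L = ∂(GK)`
(`inverseGramCurvature_quotient`). Summed against `ζ`, the first term is the sum for `E` at the
pullback of `ζ` along `G`. The second is nonnegative because `g` does not increase norms, so that `H
- G* H' G` is positive semidefinite. This second term is the contribution of the second fundamental
form. -/

namespace BottChern

/-! ### Wirtinger calculus for matrix valued functions. -/

section Wirtinger

variable {V : Type*} [NormedAddCommGroup V] [NormedSpace ℂ V]
  {l m n : Type*}

/-- The entrywise Wirtinger derivative of a matrix valued function: the `(1,0)`-part of the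
differential for `c = -I`, and the `(0,1)`-part for `c = I`. -/
noncomputable def wirtinger (c : ℂ) (A : V → Matrix m n ℂ) (y w : V) : Matrix m n ℂ :=
  Matrix.of fun i j => (1 / 2 : ℂ) *
    (fderiv ℝ (fun z => A z i j) y w + c * fderiv ℝ (fun z => A z i j) y (Complex.I • w))

/-- `∂A`. -/
local notation "dell" => wirtinger (-Complex.I)

/-- `∂̄A`. -/
local notation "dbar" => wirtinger Complex.I

theorem of_del_eq_dell (H : V → Matrix m n ℂ) (z w : V) :
    (Matrix.of fun i j => del (fun z => H z i j) z w) = dell H z w := by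
  ext i j
  simp only [del, wirtinger, Matrix.of_apply]
  ring

/-- The entries of `A` are differentiable at `y`, in the real sense. -/
def EntriesDiffAt (A : V → Matrix m n ℂ) (y : V) : Prop :=
  ∀ i j, DifferentiableAt ℝ (fun z => A z i j) y

theorem EntriesDiffAt.add {A B : V → Matrix m n ℂ} {y : V} (hA : EntriesDiffAt A y)
    (hB : EntriesDiffAt B y) : EntriesDiffAt (fun z => A z + B z) y := fun i j =>
  (hA i j).add (hB i j)

theorem EntriesDiffAt.mul [Fintype m] {A : V → Matrix l m ℂ} {B : V → Matrix m n ℂ} {y : V}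
    (hA : EntriesDiffAt A y) (hB : EntriesDiffAt B y) :
    EntriesDiffAt (fun z => A z * B z) y := by
  intro i j
  simp only [Matrix.mul_apply]
  exact DifferentiableAt.fun_sum fun k _ => (hA i k).mul (hB k j)

theorem EntriesDiffAt.conjTranspose {A : V → Matrix m n ℂ} {y : V} (hA : EntriesDiffAt A y) :
    EntriesDiffAt (fun z => (A z).conjTranspose) y := fun i j => (hA j i).star

theorem wirtinger_congr {A B : V → Matrix m n ℂ} {y : V} (h : A =ᶠ[nhds y] B) (c : ℂ) (w : V) :
    wirtinger c A y w = wirtinger c B y w := by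
  ext i j
  have : (fun z => A z i j) =ᶠ[nhds y] fun z => B z i j := h.mono fun z hz => by simp only [hz]
  simp only [wirtinger, Matrix.of_apply, this.fderiv_eq]

theorem wirtinger_const (c : ℂ) (A : Matrix m n ℂ) (y w : V) :
    wirtinger c (fun _ => A) y w = 0 := by
  ext i j
  simp [wirtinger]

theorem wirtinger_add {A B : V → Matrix m n ℂ} {y : V} (hA : EntriesDiffAt A y)
    (hB : EntriesDiffAt B y) (c : ℂ) (w : V) :
    wirtinger c (fun z => A z + B z) y w = wirtinger c A y w + wirtinger c B y w := by
  ext i j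
  simp only [wirtinger, Matrix.of_apply, Matrix.add_apply, fderiv_fun_add (hA i j) (hB i j),
    add_apply]
  ring

theorem wirtinger_const_smul {A : V → Matrix m n ℂ} {y : V} (hA : EntriesDiffAt A y)
    (a c : ℂ) (w : V) :
    wirtinger c (fun z => a • A z) y w = a • wirtinger c A y w := by
  ext i j
  simp only [wirtinger, Matrix.of_apply, Matrix.smul_apply, smul_eq_mul,
    fderiv_const_mul (hA i j), smul_apply]
  ring

theorem wirtinger_mul [Fintype m] {A : V → Matrix l m ℂ} {B : V → Matrix m n ℂ} {y : V}
    (hA : EntriesDiffAt A y) (hB : EntriesDiffAt B y) (c : ℂ) (w : V) :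
    wirtinger c (fun z => A z * B z) y w = wirtinger c A y w * B y + A y * wirtinger c B y w := by
  ext i j
  have h : ∀ u, fderiv ℝ (fun z => (A z * B z) i j) y u =
      ∑ k, (A y i k * fderiv ℝ (fun z => B z k j) y u +
        B y k j * fderiv ℝ (fun z => A z i k) y u) := by
    intro u
    simp only [Matrix.mul_apply]
    rw [fderiv_fun_sum fun k _ => (hA i k).fun_mul (hB k j), sum_apply]
    refine Finset.sum_congr rfl fun k _ => ?_
    rw [fderiv_fun_mul (hA i k) (hB k j)]
    simp
  simp only [Matrix.add_apply, Matrix.mul_apply, wirtinger, Matrix.of_apply] at h ⊢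
  simp only [h, Finset.mul_sum, ← Finset.sum_add_distrib]
  refine Finset.sum_congr rfl fun k _ => ?_
  ring

theorem conjTranspose_wirtinger (c : ℂ) (A : V → Matrix m n ℂ) (y w : V) :
    (wirtinger c A y w).conjTranspose = wirtinger (star c) (fun z => (A z).conjTranspose) y w := by
  ext i j
  have h : ∀ u, fderiv ℝ (fun z => star (A z j i)) y u =
      star (fderiv ℝ (fun z => A z j i) y u) := by
    intro u
    rw [fderiv_star]
    rfl
  simp only [Matrix.conjTranspose_apply, wirtinger, Matrix.of_apply, h, star_mul', star_add]
  congr 1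
  simp

theorem map_real_smul_add {f : V →L[ℝ] ℂ} (a : ℂ) (w : V) :
    f (a • w) = a.re * f w + a.im * f (Complex.I • w) := by
  have h : a • w = a.re • w + a.im • (Complex.I • w) := by
    conv_lhs => rw [← Complex.re_add_im a]
    rw [add_smul, mul_smul, Complex.coe_smul, Complex.coe_smul]
  rw [h, map_add, map_smul, map_smul, Complex.real_smul, Complex.real_smul]

theorem wirtinger_vec_add (c : ℂ) (A : V → Matrix m n ℂ) (y w w' : V) :
    wirtinger c A y (w + w') = wirtinger c A y w + wirtinger c A y w' := by
  ext i j
  simp only [wirtinger, Matrix.of_apply, Matrix.add_apply, smul_add, map_add]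
  ring

/-- The real differential is only real linear; splitting `a` into real and imaginary parts reduces
the claim to the values on `w` and `i w`, and taking the (1,0)-part restores complex linearity. -/
theorem dell_vec_smul (A : V → Matrix m n ℂ) (y : V) (a : ℂ) (w : V) :
    dell A y (a • w) = a • dell A y w := by
  ext i j
  simp only [wirtinger, Matrix.of_apply, Matrix.smul_apply, smul_eq_mul, ← mul_smul]
  rw [map_real_smul_add a, map_real_smul_add (Complex.I * a)]
  have := Complex.re_add_im a
  simp only [Complex.mul_re, Complex.mul_im, Complex.I_re, Complex.I_im]
  push_cast
  generalize fderiv ℝ (fun z => A z i j) y w = p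
  generalize fderiv ℝ (fun z => A z i j) y (Complex.I • w) = q
  conv_rhs => rw [← this]
  linear_combination (1 / 2 * a.im * q) * Complex.I_mul_I

theorem dbar_vec_smul (A : V → Matrix m n ℂ) (y : V) (a : ℂ) (w : V) :
    dbar A y (a • w) = star a • dbar A y w := by
  have h := dell_vec_smul (fun z => (A z).conjTranspose) y a w
  have := congrArg Matrix.conjTranspose h
  rw [Matrix.conjTranspose_smul, conjTranspose_wirtinger, conjTranspose_wirtinger] at this
  simpa using this

/-- A matrix valued function with holomorphic entries. -/
def HoloAt (G : V → Matrix m n ℂ) (y : V) : Prop :=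
  ∀ i j, DifferentiableAt ℂ (fun z => G z i j) y

theorem HoloAt.entriesDiffAt {G : V → Matrix m n ℂ} {y : V} (h : HoloAt G y) :
    EntriesDiffAt G y := fun i j => (h i j).restrictScalars ℝ

/-- The Cauchy–Riemann equations: a complex linear differential makes the two halves cancel, since
`1 + i * i = 0`. -/
theorem HoloAt.dbar_eq_zero {G : V → Matrix m n ℂ} {y : V} (h : HoloAt G y) (w : V) :
    dbar G y w = 0 := by
  ext i j
  simp only [wirtinger, Matrix.of_apply, (h i j).fderiv_restrictScalars ℝ,
    ContinuousLinearMap.coe_restrictScalars', map_smul, smul_eq_mul, Matrix.zero_apply]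
  linear_combination (1 / 2 * fderiv ℂ (fun z => G z i j) y w) * Complex.I_mul_I

theorem HoloAt.dell_conjTranspose {G : V → Matrix m n ℂ} {y : V} (h : HoloAt G y) (w : V) :
    dell (fun z => (G z).conjTranspose) y w = 0 := by
  have := conjTranspose_wirtinger Complex.I G y w
  rw [h.dbar_eq_zero, Matrix.conjTranspose_zero] at this
  simpa using this.symm

theorem dbar_conjTranspose (G : V → Matrix m n ℂ) (y w : V) :
    dbar (fun z => (G z).conjTranspose) y w = (dell G y w).conjTranspose := by
  rw [conjTranspose_wirtinger]
  simp

/-- Near `y` the function `∂G(w)` is the complex derivative of `G` along `w`. Its holomorphy is what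
gives `∂̄∂G = 0` later. -/
theorem holoAt_dell {G : V → Matrix m n ℂ} {y : V}
    (hG : ∀ i j, ContDiffAt ℂ 2 (fun z => G z i j) y) (w : V) :
    HoloAt (fun z => dell G z w) y := by
  intro i j
  have h1 : DifferentiableAt ℂ (fderiv ℂ fun z => G z i j) y :=
    ((hG i j).fderiv_right (m := 1) (by norm_num)).differentiableAt (by norm_num)
  have h2 : DifferentiableAt ℂ (fun z => fderiv ℂ (fun z => G z i j) z w) y :=
    h1.clm_apply (differentiableAt_const w)
  refine h2.congr_of_eventuallyEq ?_
  have h3 : ∀ᶠ z in nhds y, DifferentiableAt ℂ (fun z => G z i j) z :=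
    ((hG i j).eventually (by simp)).mono fun z hz => hz.differentiableAt (by norm_num)
  filter_upwards [h3] with z hz
  simp only [wirtinger, Matrix.of_apply, hz.fderiv_restrictScalars ℝ,
    ContinuousLinearMap.coe_restrictScalars', map_smul, smul_eq_mul]
  linear_combination (-1 / 2 * fderiv ℂ (fun z => G z i j) z w) * Complex.I_mul_I

theorem entriesDiffAt_wirtinger {A : V → Matrix m n ℂ} {y : V}
    (hA : ∀ i j, ContDiffAt ℝ 2 (fun z => A z i j) y) (c : ℂ) (w : V) :
    EntriesDiffAt (fun z => wirtinger c A z w) y := by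
  intro i j
  have h1 : DifferentiableAt ℝ (fderiv ℝ fun z => A z i j) y :=
    ((hA i j).fderiv_right (m := 1) (by norm_num)).differentiableAt (by norm_num)
  have h2 : ∀ u, DifferentiableAt ℝ (fun z => fderiv ℝ (fun z => A z i j) z u) y := fun u =>
    h1.clm_apply (differentiableAt_const u)
  exact ((h2 w).add ((h2 _).const_mul c)).const_mul (1 / 2 : ℂ)

end Wirtinger

/-! ### Curvature in terms of the inverse Gram matrix. -/

section Inverse

variable {V : Type*} [NormedAddCommGroup V] [NormedSpace ℂ V]
  {ι : Type*} [Fintype ι] [DecidableEq ι] {k : ℕ∞ω}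

theorem contDiffAt_det {A : V → Matrix ι ι ℂ} {y : V}
    (hA : ∀ i j, ContDiffAt ℝ k (fun z => A z i j) y) :
    ContDiffAt ℝ k (fun z => (A z).det) y := by
  simp only [Matrix.det_apply]
  refine ContDiffAt.sum fun σ _ => ContDiffAt.const_smul _ ?_
  exact contDiffAt_prod fun i _ => hA _ _

theorem contDiffAt_inv_entries {A : V → Matrix ι ι ℂ} {y : V}
    (hA : ∀ i j, ContDiffAt ℝ k (fun z => A z i j) y) (hy : IsUnit (A y).det) (i j : ι) :
    ContDiffAt ℝ k (fun z => (A z)⁻¹ i j) y := by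
  simp only [Matrix.inv_def, Matrix.smul_apply, Ring.inverse_eq_inv', smul_eq_mul,
    Matrix.adjugate_apply]
  refine ((contDiffAt_det hA).inv hy.ne_zero).mul (contDiffAt_det fun a b => ?_)
  -- Cramer's rule: the entry of the adjugate is a determinant with row `j` replaced by a constant
  -- vector.
  by_cases h : a = j
  · subst h
    simpa only [Matrix.updateRow_self] using contDiffAt_const
  · simpa only [Matrix.updateRow_ne h] using hA a b

theorem eventually_isUnit_det {A : V → Matrix ι ι ℂ} {y : V}
    (hA : ∀ i j, ContDiffAt ℝ k (fun z => A z i j) y) (hy : IsUnit (A y).det) :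
    ∀ᶠ z in nhds y, IsUnit (A z).det :=
  ((contDiffAt_det hA).continuousAt.eventually_ne hy.ne_zero).mono fun _ hz => hz.isUnit

local notation "dell" => wirtinger (-Complex.I)
local notation "dbar" => wirtinger Complex.I

/-- The expression of the curvature in terms of the inverse `K` of the Gram matrix. -/
noncomputable def inverseGramCurvature (H : V → Matrix ι ι ℂ) (y v w : V) : Matrix ι ι ℂ :=
  dbar (fun z => dell (fun z => (H z)⁻¹) z v) y w -
    dell (fun z => (H z)⁻¹) y v * H y * dbar (fun z => (H z)⁻¹) y w

variable {H : V → Matrix ι ι ℂ} {y : V}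

theorem chernForm_smul_I (z w : V) :
    chernForm H z (Complex.I • w) = Complex.I • chernForm H z w := by
  rw [chernForm, chernForm, ← Matrix.mul_smul]
  congr 1
  ext i j
  simp [del_smul_I]

/-- Differentiate `H⁻¹ H = 1`, which holds near `y`. -/
theorem mul_wirtinger_inv (hH : ∀ i j, ContDiffAt ℝ 2 (fun z => H z i j) y)
    (hy : IsUnit (H y).det) (c : ℂ) (w : V) :
    (H y)⁻¹ * wirtinger c H y w = -(wirtinger c (fun z => (H z)⁻¹) y w * H y) := by
  have h1 : EntriesDiffAt (fun z => (H z)⁻¹) y := fun i j =>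
    (contDiffAt_inv_entries hH hy i j).differentiableAt (by norm_num)
  have h2 : EntriesDiffAt H y := fun i j => (hH i j).differentiableAt (by norm_num)
  have h3 := wirtinger_mul h1 h2 c w
  have h4 : (fun z => (H z)⁻¹ * H z) =ᶠ[nhds y] fun _ => 1 :=
    (eventually_isUnit_det hH hy).mono fun z hz => Matrix.nonsing_inv_mul _ hz
  rw [wirtinger_congr h4, wirtinger_const] at h3
  exact eq_neg_of_add_eq_zero_right h3.symm

/-- Since `θ` has type (1,0), both `∂θ` and `θ ∧ θ` have type (2,0) and vanish on `(ξ, η̄)`. In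
`dθ(ξ, η̄)` only the derivative of `θ(ξ)` along `η̄` survives, with a minus sign. -/
theorem mixed_curvatureForm_eq_neg_dbar (hH : ∀ i j, ContDiffAt ℝ 2 (fun z => H z i j) y)
    (hy : IsUnit (H y).det) (v w : V) :
    mixed (curvatureForm (chernForm H) y) v w = -dbar (fun z => chernForm H z v) y w := by
  have hI : Complex.I • Complex.I • w = -w := by
    rw [smul_smul, Complex.I_mul_I, neg_one_smul]
  have hI' : Complex.I • Complex.I • v = -v := by
    rw [smul_smul, Complex.I_mul_I, neg_one_smul]
  have hd : ∀ u, EntriesDiffAt (fun z => chernForm H z u) y := by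
    intro u
    have h1 : EntriesDiffAt (fun z => (H z)⁻¹) y := fun i j =>
      (contDiffAt_inv_entries hH hy i j).differentiableAt (by norm_num)
    simp only [chernForm, of_del_eq_dell]
    exact h1.mul (entriesDiffAt_wirtinger hH _ u)
  have hs : ∀ u x i j, fderiv ℝ (fun z => Complex.I * chernForm H z u i j) y x =
      Complex.I * fderiv ℝ (fun z => chernForm H z u i j) y x := by
    intro u x i j
    rw [fderiv_const_mul (hd u i j)]
    rfl
  ext i j
  simp only [mixed, curvatureForm, chernForm_smul_I, Matrix.smul_apply, Matrix.add_apply,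
    Matrix.sub_apply, Matrix.of_apply, wirtinger, Matrix.neg_apply, Matrix.smul_mul,
    Matrix.mul_smul, smul_eq_mul, hs]
  generalize fderiv ℝ (fun z => chernForm H z v i j) y w = a
  generalize fderiv ℝ (fun z => chernForm H z v i j) y (Complex.I • w) = b
  generalize fderiv ℝ (fun z => chernForm H z w i j) y v = c
  generalize fderiv ℝ (fun z => chernForm H z w i j) y (Complex.I • v) = d
  generalize (chernForm H y v * chernForm H y w) i j = p
  generalize (chernForm H y w * chernForm H y v) i j = q
  have := Complex.I_sq
  ring_nf
  rw [this]
  ring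

/-- With `K = H⁻¹`, the connection form is `θ = -∂K H` near `y`, so `-∂̄θ = ∂̄∂K H + ∂K ∂̄H`; then
substitute `∂̄H = -H ∂̄K H` and cancel the last `H`. -/
theorem mixed_curvatureForm_mul_inv (hH : ∀ i j, ContDiffAt ℝ 2 (fun z => H z i j) y)
    (hy : IsUnit (H y).det) (v w : V) :
    mixed (curvatureForm (chernForm H) y) v w * (H y)⁻¹ = inverseGramCurvature H y v w := by
  have hK : ∀ i j, ContDiffAt ℝ 2 (fun z => (H z)⁻¹ i j) y := contDiffAt_inv_entries hH hy
  have hev : (fun z => chernForm H z v) =ᶠ[nhds y]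
      fun z => (-1 : ℂ) • (dell (fun z => (H z)⁻¹) z v * H z) := by
    have h1 : ∀ᶠ z in nhds y, ∀ i j, ContDiffAt ℝ 2 (fun z => H z i j) z := by
      simp only [Filter.eventually_all]
      exact fun i j => (hH i j).eventually (by simp)
    filter_upwards [h1, eventually_isUnit_det hH hy] with z hz hz'
    rw [chernForm, of_del_eq_dell, mul_wirtinger_inv hz hz', neg_one_smul]
  have hd : EntriesDiffAt H y := fun i j => (hH i j).differentiableAt (by norm_num)
  have hd' := entriesDiffAt_wirtinger hK (-Complex.I) v
  rw [mixed_curvatureForm_eq_neg_dbar hH hy, wirtinger_congr hev,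
    wirtinger_const_smul (hd'.mul hd), wirtinger_mul hd' hd, neg_one_smul, neg_neg, add_mul,
    Matrix.mul_nonsing_inv_cancel_right _ _ hy, inverseGramCurvature, sub_eq_add_neg]
  congr 1
  have h := mul_wirtinger_inv hH hy Complex.I w
  have h' : dbar H y w = -(H y * dbar (fun z => (H z)⁻¹) y w * H y) := by
    rw [mul_assoc, ← mul_neg, ← h, Matrix.mul_nonsing_inv_cancel_left _ _ hy]
  rw [mul_assoc, h', neg_mul, Matrix.mul_nonsing_inv_cancel_right _ _ hy, mul_neg, ← mul_assoc]

theorem inverseGramCurvature_add_left (hH : ∀ i j, ContDiffAt ℝ 2 (fun z => H z i j) y)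
    (hy : IsUnit (H y).det) (v v' w : V) :
    inverseGramCurvature H y (v + v') w =
      inverseGramCurvature H y v w + inverseGramCurvature H y v' w := by
  have hK := entriesDiffAt_wirtinger (contDiffAt_inv_entries hH hy) (-Complex.I)
  simp only [inverseGramCurvature, wirtinger_vec_add, wirtinger_add (hK v) (hK v'), add_mul]
  abel

theorem inverseGramCurvature_smul_left (hH : ∀ i j, ContDiffAt ℝ 2 (fun z => H z i j) y)
    (hy : IsUnit (H y).det) (a : ℂ) (v w : V) :
    inverseGramCurvature H y (a • v) w = a • inverseGramCurvature H y v w := by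
  have hK := entriesDiffAt_wirtinger (contDiffAt_inv_entries hH hy) (-Complex.I)
  simp only [inverseGramCurvature, dell_vec_smul, wirtinger_const_smul (hK v), Matrix.smul_mul,
    smul_sub]

/-- The curvature, multiplied by the inverse of the Gram matrix, is sesquilinear. -/
noncomputable def inverseGramCurvatureLin (hH : ∀ i j, ContDiffAt ℝ 2 (fun z => H z i j) y)
    (hy : IsUnit (H y).det) : V →ₗ[ℂ] V →ₗ⋆[ℂ] Matrix ι ι ℂ :=
  LinearMap.mk₂'ₛₗ (RingHom.id ℂ) (starRingEnd ℂ) (inverseGramCurvature H y)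
    (inverseGramCurvature_add_left hH hy) (inverseGramCurvature_smul_left hH hy)
    (fun v w w' => by
      simp only [inverseGramCurvature, wirtinger_vec_add, mul_add]
      abel)
    (fun a v w => by
      simp only [inverseGramCurvature, dbar_vec_smul, Matrix.mul_smul, smul_sub]
      rfl)

/-- The inverse Gram curvature of a quotient, in terms of the one of the total space and of the
second fundamental form. -/
theorem inverseGramCurvature_quotient {κ : Type*} [Fintype κ] [DecidableEq κ]
    (hH : ∀ i j, ContDiffAt ℝ 2 (fun z => H z i j) y) (hy : IsUnit (H y).det)
    (hherm : ∀ᶠ z in nhds y, (H z).IsHermitian)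
    {H' : V → Matrix κ κ ℂ} {G : V → Matrix κ ι ℂ}
    (hG : ∀ i j, ContDiffAt ℂ 2 (fun z => G z i j) y)
    (hHG : ∀ᶠ z in nhds y, (H' z)⁻¹ = G z * (H z)⁻¹ * (G z).conjTranspose) (v w : V) :
    inverseGramCurvature H' y v w =
      G y * inverseGramCurvature H y v w * (G y).conjTranspose +
      (dell G y v * (H y)⁻¹ + G y * dell (fun z => (H z)⁻¹) y v) *
        (H y - (G y).conjTranspose * H' y * G y) *
        (dell G y w * (H y)⁻¹ + G y * dell (fun z => (H z)⁻¹) y w).conjTranspose := by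
  set K : V → Matrix ι ι ℂ := fun z => (H z)⁻¹ with hKdef
  have hK2 : ∀ i j, ContDiffAt ℝ 2 (fun z => K z i j) y := contDiffAt_inv_entries hH hy
  have hKd : EntriesDiffAt K y := fun i j => (hK2 i j).differentiableAt (by norm_num)
  have hG0 : HoloAt G y := fun i j => (hG i j).differentiableAt (by norm_num)
  have hGd := hG0.entriesDiffAt
  have hKev : ∀ᶠ z in nhds y, EntriesDiffAt K z := by
    have h1 : ∀ᶠ z in nhds y, ∀ i j, ContDiffAt ℝ 2 (fun z => K z i j) z := by
      simp only [Filter.eventually_all]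
      exact fun i j => (hK2 i j).eventually (by simp)
    exact h1.mono fun z hz i j => (hz i j).differentiableAt (by norm_num)
  have hGev : ∀ᶠ z in nhds y, HoloAt G z := by
    have h1 : ∀ᶠ z in nhds y, ∀ i j, ContDiffAt ℂ 2 (fun z => G z i j) z := by
      simp only [Filter.eventually_all]
      exact fun i j => (hG i j).eventually (by simp)
    exact h1.mono fun z hz i j => (hz i j).differentiableAt (by norm_num)
  have hKstar : ∀ u, (dell K y u).conjTranspose = dbar K y u := by
    intro u
    have h1 : (fun z => (K z).conjTranspose) =ᶠ[nhds y] K :=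
      hherm.mono fun z hz => hz.inv
    rw [← dbar_conjTranspose, wirtinger_congr h1]
  have hKy : (K y).conjTranspose = K y := hherm.self_of_nhds.inv
  have hcongr : (fun z => (H' z)⁻¹) =ᶠ[nhds y] fun z => G z * K z * (G z).conjTranspose := hHG
  -- `G*` is antiholomorphic, so `∂` does not see it: `∂K' = L G*`. The identity is needed on a
  -- neighbourhood because `∂̄` is applied to it next.
  have hdell : ∀ u, (fun z => dell (fun z => (H' z)⁻¹) z u) =ᶠ[nhds y]
      fun z => (dell G z u * K z + G z * dell K z u) * (G z).conjTranspose := by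
    intro u
    filter_upwards [hcongr.eventuallyEq_nhds, hKev, hGev] with z h1 h2 h3
    rw [wirtinger_congr h1,
      wirtinger_mul (h3.entriesDiffAt.mul h2) h3.entriesDiffAt.conjTranspose,
      wirtinger_mul h3.entriesDiffAt h2, h3.dell_conjTranspose, Matrix.mul_zero, add_zero]
  have hdb : dbar (fun z => (H' z)⁻¹) y w =
      G y * (dell G y w * K y + G y * dell K y w).conjTranspose := by
    rw [wirtinger_congr hcongr, wirtinger_mul (hGd.mul hKd) hGd.conjTranspose,
      wirtinger_mul hGd hKd, hG0.dbar_eq_zero, dbar_conjTranspose, Matrix.zero_mul, zero_add,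
      Matrix.conjTranspose_add, Matrix.conjTranspose_mul, Matrix.conjTranspose_mul, hKstar, hKy,
      Matrix.mul_add, ← Matrix.mul_assoc, ← Matrix.mul_assoc, add_comm]
  have hdelG := holoAt_dell hG v
  have hdelGd := hdelG.entriesDiffAt
  have hdelK := entriesDiffAt_wirtinger hK2 (-Complex.I) v
  have hddb : dbar (fun z => dell (fun z => (H' z)⁻¹) z v) y w =
      (dell G y v * dbar K y w + G y * dbar (fun z => dell K z v) y w) * (G y).conjTranspose +
      (dell G y v * K y + G y * dell K y v) * (dell G y w).conjTranspose := by
    rw [wirtinger_congr (hdell v),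
      wirtinger_mul ((hdelGd.mul hKd).add (hGd.mul hdelK)) hGd.conjTranspose,
      wirtinger_add (hdelGd.mul hKd) (hGd.mul hdelK), wirtinger_mul hdelGd hKd,
      wirtinger_mul hGd hdelK, hdelG.dbar_eq_zero, hG0.dbar_eq_zero, dbar_conjTranspose,
      Matrix.zero_mul, zero_add, Matrix.zero_mul, zero_add]
  have hKH : K y * H y = 1 := Matrix.nonsing_inv_mul _ hy
  have hHK : H y * K y = 1 := Matrix.mul_nonsing_inv _ hy
  have e1 : ∀ B : Matrix ι κ ℂ, H y * (K y * B) = B := fun B => by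
    rw [← Matrix.mul_assoc, hHK, Matrix.one_mul]
  have e2 : ∀ B : Matrix ι κ ℂ, K y * (H y * B) = B := fun B => by
    rw [← Matrix.mul_assoc, hKH, Matrix.one_mul]
  rw [inverseGramCurvature, inverseGramCurvature, hddb, hdb,
    show dell (fun z => (H' z)⁻¹) y v = _ from (hdell v).eq_of_nhds,
    ← hKdef, show (H y)⁻¹ = K y from rfl]
  -- The term `∂K' H' ∂̄K'` is `L G* H' G L*`. Expanding `L H L*` with `HK = KH = 1` produces `∂̄∂K'
  -- - G R G*`, where `R` is the expression for `H`.
  simp only [Matrix.conjTranspose_add, Matrix.conjTranspose_mul, hKstar, hKy,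
    Matrix.mul_sub, Matrix.sub_mul, Matrix.mul_add, Matrix.add_mul,
    Matrix.mul_assoc, e1, e2]
  abel

end Inverse

/-! ### Contracting sesquilinear matrix valued forms. -/

section Contraction

variable {T : Type*} [AddCommGroup T] [Module ℂ T]
  {ι κ : Type*} [Fintype ι] [Fintype κ]

theorem sum_sum_comm (F : ι → ι → κ → κ → ℂ) :
    ∑ i, ∑ j, ∑ a, ∑ b, F i j a b = ∑ a, ∑ b, ∑ i, ∑ j, F i j a b :=
  calc
    ∑ i, ∑ j, ∑ a, ∑ b, F i j a b = ∑ i, ∑ a, ∑ j, ∑ b, F i j a b :=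
      Finset.sum_congr rfl fun _ _ => Finset.sum_comm
    _ = ∑ a, ∑ i, ∑ j, ∑ b, F i j a b := Finset.sum_comm
    _ = ∑ a, ∑ i, ∑ b, ∑ j, F i j a b :=
      Finset.sum_congr rfl fun _ _ => Finset.sum_congr rfl fun _ _ => Finset.sum_comm
    _ = ∑ a, ∑ b, ∑ i, ∑ j, F i j a b := Finset.sum_congr rfl fun _ _ => Finset.sum_comm

theorem mul_mul_conjTranspose_apply {κ : Type*} (L L' : Matrix κ ι ℂ) (P : Matrix ι ι ℂ) (a b : κ) :
    (L * P * L'.conjTranspose) a b = ∑ i, ∑ j, L a i * P i j * star (L' b j) := by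
  simp only [Matrix.mul_apply, Matrix.conjTranspose_apply, Finset.sum_mul]
  exact Finset.sum_comm

/-- Transforming the tangent vectors by `G` amounts to replacing `R` by `G R G*`. This serves both
for changing frames and for pulling back along `g`. -/
theorem sum_sesquilinear_apply (R : T →ₗ[ℂ] T →ₗ⋆[ℂ] Matrix ι ι ℂ) (G : Matrix κ ι ℂ)
    (ζ : κ → T) :
    ∑ i, ∑ j, R (∑ a, G a i • ζ a) (∑ b, G b j • ζ b) i j =
      ∑ a, ∑ b, (G * R (ζ a) (ζ b) * G.conjTranspose) a b := by
  have h1 : ∀ i j, R (∑ a, G a i • ζ a) (∑ b, G b j • ζ b) i j =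
      ∑ a, ∑ b, G a i * R (ζ a) (ζ b) i j * star (G b j) := by
    intro i j
    simp only [map_sum, LinearMap.sum_apply, map_smul, LinearMap.smul_apply,
      LinearMap.map_smulₛₗ, Matrix.sum_apply, Matrix.smul_apply, smul_eq_mul, starRingEnd_apply]
    rw [Finset.sum_comm]
    refine Finset.sum_congr rfl fun a _ => ?_
    rw [mul_comm, Finset.sum_mul]
  simp only [h1, mul_mul_conjTranspose_apply]
  exact sum_sum_comm _

/-- The double sum is `u* P u` for the single vector `u` with `u_i = ∑ b, star (L b b i)`. -/
theorem sum_mul_mul_conjTranspose_nonneg {P : Matrix ι ι ℂ} (hP : P.PosSemidef)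
    (L : κ → Matrix κ ι ℂ) :
    0 ≤ ∑ a, ∑ b, (L a * P * (L b).conjTranspose) a b := by
  have h := hP.dotProduct_mulVec_nonneg fun i => ∑ b, star (L b b i)
  refine h.trans_eq ?_
  simp only [mul_mul_conjTranspose_apply]
  rw [← sum_sum_comm]
  simp only [dotProduct, Matrix.mulVec, Pi.star_apply, star_sum, star_star, Finset.mul_sum]
  refine Finset.sum_congr rfl fun i _ => Finset.sum_congr rfl fun j _ => ?_
  rw [Finset.sum_comm]
  simp only [Finset.sum_mul, mul_assoc]

end Contraction

/-! ### From orthonormal bases to arbitrary frames. -/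

section Frame

variable {T : Type*} [AddCommGroup T] [Module ℂ T]
  {W : Type*} [NormedAddCommGroup W] [InnerProductSpace ℂ W]
  {ι κ : Type*} [Fintype ι]

/-- The contraction of `t ∈ T ⊗ W^*` with a vector of `W`. -/
noncomputable def contractVec (t : T ⊗[ℂ] Module.Dual ℂ W) : W →ₗ[ℂ] T where
  toFun u := TensorProduct.rid ℂ T ((Module.Dual.eval ℂ W u).lTensor T t)
  map_add' u v := by rw [map_add, LinearMap.lTensor_add, LinearMap.add_apply, map_add]
  map_smul' c u := by
    rw [map_smul, LinearMap.lTensor_smul, LinearMap.smul_apply, map_smul, RingHom.id_apply]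

theorem coeff_eq_contractVec (e : OrthonormalBasis ι ℂ W) (j : ι) (t : T ⊗[ℂ] Module.Dual ℂ W) :
    coeff e j t = contractVec t (e j) := rfl

theorem contractVec_sum_tmul_coord [Fintype κ] (f : Module.Basis κ ℂ W) (Z : κ → T) (k : κ) :
    contractVec (∑ i, Z i ⊗ₜ[ℂ] f.coord i) (f k) = Z k := by
  simp only [contractVec, LinearMap.coe_mk, AddHom.coe_mk, map_sum, LinearMap.lTensor_tmul,
    TensorProduct.rid_tmul, Module.Dual.eval_apply, Module.Basis.coord_apply,
    Module.Basis.repr_self]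
  rw [Finset.sum_eq_single k]
  · simp
  · intro i _ hi
    simp [hi.symm]
  · simp

theorem gram_eq_toMatrix (e : OrthonormalBasis ι ℂ W) (f : Module.Basis κ ℂ W) :
    Matrix.gram ℂ f = (e.toBasis.toMatrix f).conjTranspose * e.toBasis.toMatrix f := by
  rw [Matrix.gram_eq_conjTranspose_mul e]
  rfl

theorem conjTranspose_toMatrix_mul_gram_mul {W' : Type*} [NormedAddCommGroup W']
    [InnerProductSpace ℂ W'] [FiniteDimensional ℂ W'] [Fintype κ] [DecidableEq ι]
    (f : Module.Basis ι ℂ W) (f' : Module.Basis κ ℂ W') (g : W →ₗ[ℂ] W') :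
    (LinearMap.toMatrix f f' g).conjTranspose * Matrix.gram ℂ f' * LinearMap.toMatrix f f' g =
      Matrix.gram ℂ (g ∘ f) := by
  have e := stdOrthonormalBasis ℂ W'
  rw [gram_eq_toMatrix e f', Matrix.gram_eq_conjTranspose_mul e]
  have h : (Matrix.of fun i j => e.repr ((g ∘ f) j) i) =
      e.toBasis.toMatrix f' * LinearMap.toMatrix f f' g := by
    rw [basis_toMatrix_mul_linearMap_toMatrix]
    ext i j
    rw [LinearMap.toMatrix_apply]
    rfl
  simp only [h, Matrix.conjTranspose_mul, Matrix.mul_assoc]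

theorem isUnit_det_gram [Fintype κ] [DecidableEq κ] (f : Module.Basis κ ℂ W) :
    IsUnit (Matrix.gram ℂ f).det :=
  (Matrix.det_gram_ne_zero_iff_linearIndependent.2 f.linearIndependent).isUnit

/-- The Bott–Chern form can be computed in any frame, after multiplying the curvature matrix by the
inverse of the Gram matrix. -/
theorem bottChernForm_toLin [Fintype κ] [DecidableEq κ] (e : OrthonormalBasis ι ℂ W)
    (f : Module.Basis κ ℂ W)
    (M : T → T → Matrix κ κ ℂ) (c : ℂ) (R : T →ₗ[ℂ] T →ₗ⋆[ℂ] Matrix κ κ ℂ)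
    (hR : ∀ v w, mixed M v w * (Matrix.gram ℂ f)⁻¹ = R v w) (t : T ⊗[ℂ] Module.Dual ℂ W) :
    bottChernForm (fun v w => c • Matrix.toLin f f (M v w)) e t t =
      -Complex.I * c * ∑ a, ∑ b, R (contractVec t (f a)) (contractVec t (f b)) a b := by
  classical
  set U := f.toMatrix e with hU
  set m := e.toBasis.toMatrix f with hm
  have hmU : m * U = 1 := by
    rw [hm, hU, ← e.coe_toBasis, Module.Basis.toMatrix_mul_toMatrix_flip]
  have hUm : U * m = 1 := by
    rw [hm, hU, ← e.coe_toBasis, Module.Basis.toMatrix_mul_toMatrix_flip]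
  have hgram := gram_eq_toMatrix e f
  have hmixed : ∀ v w, mixed (fun v w => c • Matrix.toLin f f (M v w)) v w =
      c • Matrix.toLin f f (mixed M v w) := by
    intro v w
    simp only [mixed, map_smul, map_add, map_sub]
    module
  have hM : ∀ v w, mixed M v w = R v w * Matrix.gram ℂ f := by
    intro v w
    rw [← hR, Matrix.nonsing_inv_mul_cancel_right _ _ (isUnit_det_gram f)]
  have hinner : ∀ v w j k, ⟪e j, mixed (fun v w => c • Matrix.toLin f f (M v w)) v w (e k)⟫_ℂ =
      c * (m * R v w * m.conjTranspose) j k := by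
    intro v w j k
    rw [hmixed, LinearMap.smul_apply, inner_smul_right]
    congr 1
    have h1 : m * mixed M v w * U = LinearMap.toMatrix e.toBasis e.toBasis
        (Matrix.toLin f f (mixed M v w)) := by
      have h := basis_toMatrix_mul_linearMap_toMatrix_mul_basis_toMatrix e.toBasis f e.toBasis f
        (Matrix.toLin f f (mixed M v w))
      rwa [LinearMap.toMatrix_toLin, e.coe_toBasis] at h
    -- Here the curvature matrix is `R m* m`, and `m U = 1` absorbs the last factor.
    have h2 : m * mixed M v w * U = m * R v w * m.conjTranspose := by
      rw [hM, hgram]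
      simp only [Matrix.mul_assoc]
      rw [hmU, Matrix.mul_one]
    rw [← h2, h1, LinearMap.toMatrix_apply, e.coe_toBasis, ← e.repr_apply_apply]
    rfl
  have hcoeff : ∀ j, coeff e j t = ∑ a, U a j • contractVec t (f a) := by
    intro j
    rw [coeff_eq_contractVec]
    conv_lhs => rw [← f.sum_repr (e j)]
    rw [map_sum]
    exact Finset.sum_congr rfl fun a _ => by rw [map_smul]; rfl
  -- `R'` is `R` written in the orthonormal basis. The vectors `coeff e j t` are transformed by `U`,
  -- and `U (m R m*) U* = R` undoes the change of basis.
  let R' : T →ₗ[ℂ] T →ₗ⋆[ℂ] Matrix ι ι ℂ :=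
    LinearMap.mk₂'ₛₗ (RingHom.id ℂ) (starRingEnd ℂ) (fun v w => m * R v w * m.conjTranspose)
      (fun v v' w => by simp only [map_add, LinearMap.add_apply, Matrix.mul_add, Matrix.add_mul])
      (fun a v w => by
        simp only [map_smul, LinearMap.smul_apply, Matrix.mul_smul, Matrix.smul_mul,
          RingHom.id_apply])
      (fun v w w' => by simp only [map_add, Matrix.mul_add, Matrix.add_mul])
      (fun a v w => by simp only [LinearMap.map_smulₛₗ, Matrix.mul_smul, Matrix.smul_mul])
  have key := sum_sesquilinear_apply R' U fun a => contractVec t (f a)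
  have hR' : ∀ v w, R' v w = m * R v w * m.conjTranspose := fun _ _ => rfl
  have hback : ∀ B : Matrix κ κ ℂ, U * (m * B * m.conjTranspose) * U.conjTranspose = B := by
    intro B
    rw [Matrix.mul_assoc, Matrix.mul_assoc, Matrix.mul_assoc, ← Matrix.conjTranspose_mul, hUm,
      Matrix.conjTranspose_one, Matrix.mul_one, ← Matrix.mul_assoc, hUm, Matrix.one_mul]
  simp only [hR', hback] at key
  rw [← key, bottChernForm, Finset.mul_sum]
  refine Finset.sum_congr rfl fun j _ => ?_
  rw [Finset.mul_sum]
  refine Finset.sum_congr rfl fun k _ => ?_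
  rw [hinner, hcoeff, hcoeff, mul_assoc]

end Frame

/-! ### Linear algebra of the quotient metric. -/

section Quotient

variable {W W' : Type*} [NormedAddCommGroup W] [InnerProductSpace ℂ W] [FiniteDimensional ℂ W]
  [NormedAddCommGroup W'] [InnerProductSpace ℂ W']
  {ι κ : Type*} [Fintype ι] [Fintype κ] [DecidableEq ι]
  {g : W →ₗ[ℂ] W'}

theorem exists_mem_ker_orthogonal (g : W →ₗ[ℂ] W') (u : W) :
    ∃ p ∈ (LinearMap.ker g)ᗮ, g p = g u ∧ ⟪p, u - p⟫_ℂ = 0 ∧ u - p ∈ LinearMap.ker g := by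
  obtain ⟨q, hq, p, hp, rfl⟩ := (LinearMap.ker g).exists_add_mem_mem_orthogonal u
  refine ⟨p, hp, ?_, ?_, ?_⟩
  · rw [map_add, LinearMap.mem_ker.1 hq, zero_add]
  · rw [add_sub_cancel_right]
    exact Submodule.inner_left_of_mem_orthogonal hq hp
  · rwa [add_sub_cancel_right]

/-- By Pythagoras: `g` sees only the component of `u` orthogonal to the kernel, and is isometric
there. -/
theorem inner_apply_self_le
    (hiso : ∀ u ∈ (LinearMap.ker g)ᗮ, ∀ v ∈ (LinearMap.ker g)ᗮ, ⟪g u, g v⟫_ℂ = ⟪u, v⟫_ℂ) (u : W) :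
    ⟪g u, g u⟫_ℂ ≤ ⟪u, u⟫_ℂ := by
  obtain ⟨p, hp, hpu, ho, -⟩ := exists_mem_ker_orthogonal g u
  have h : ⟪u, u⟫_ℂ = ⟪p, p⟫_ℂ + ⟪u - p, u - p⟫_ℂ := by
    have ho' : ⟪u - p, p⟫_ℂ = 0 := inner_eq_zero_symm.1 ho
    conv_lhs => rw [← add_sub_cancel p u]
    rw [inner_add_left, inner_add_right, inner_add_right, ho, ho', add_zero, zero_add]
  rw [← hpu, hiso p hp p hp, h, le_add_iff_nonneg_right, inner_self_eq_norm_sq_to_K]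
  rw [← RCLike.ofReal_pow]
  exact RCLike.ofReal_nonneg.2 (sq_nonneg _)

variable [FiniteDimensional ℂ W']

/-- A vector of the quotient lifts to some `p` orthogonal to the kernel, and `g* g p = p`: testing
against `v`, only the orthogonal component of `v` contributes on either side. -/
theorem comp_adjoint_eq_id (hsurj : Function.Surjective g)
    (hiso : ∀ u ∈ (LinearMap.ker g)ᗮ, ∀ v ∈ (LinearMap.ker g)ᗮ, ⟪g u, g v⟫_ℂ = ⟪u, v⟫_ℂ) :
    g ∘ₗ LinearMap.adjoint g = LinearMap.id := by
  ext x
  obtain ⟨u, rfl⟩ := hsurj x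
  obtain ⟨p, hp, hpu, -, -⟩ := exists_mem_ker_orthogonal g u
  rw [← hpu, LinearMap.comp_apply, LinearMap.id_apply]
  congr 1
  refine ext_inner_right ℂ fun v => ?_
  obtain ⟨q, hq, hqv, -, hk⟩ := exists_mem_ker_orthogonal g v
  rw [LinearMap.adjoint_inner_left, ← hqv, hiso p hp q hq, ← sub_eq_zero, ← inner_sub_right,
    ← neg_sub, inner_neg_right, Submodule.inner_left_of_mem_orthogonal hk hp, neg_zero]

theorem gram_mul_toMatrix_adjoint [DecidableEq κ] (f : Module.Basis ι ℂ W)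
    (f' : Module.Basis κ ℂ W')
    (g : W →ₗ[ℂ] W') :
    Matrix.gram ℂ f * LinearMap.toMatrix f' f (LinearMap.adjoint g) =
      (LinearMap.toMatrix f f' g).conjTranspose * Matrix.gram ℂ f' := by
  ext i j
  have h1 : ⟪f i, LinearMap.adjoint g (f' j)⟫_ℂ = ⟪g (f i), f' j⟫_ℂ :=
    LinearMap.adjoint_inner_right g (f i) (f' j)
  rw [← f.sum_repr (LinearMap.adjoint g (f' j)), ← f'.sum_repr (g (f i)), inner_sum,
    sum_inner] at h1
  simp only [Matrix.mul_apply, Matrix.gram_apply, LinearMap.toMatrix_apply,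
    Matrix.conjTranspose_apply]
  simp only [inner_smul_left, inner_smul_right, starRingEnd_apply] at h1
  rw [← h1]
  exact Finset.sum_congr rfl fun k _ => mul_comm _ _

/-- The inverse Gram matrix of the quotient metric. -/
theorem inv_gram_quotient [DecidableEq κ] (f : Module.Basis ι ℂ W)
    (f' : Module.Basis κ ℂ W')
    (hsurj : Function.Surjective g)
    (hiso : ∀ u ∈ (LinearMap.ker g)ᗮ, ∀ v ∈ (LinearMap.ker g)ᗮ, ⟪g u, g v⟫_ℂ = ⟪u, v⟫_ℂ) :
    (Matrix.gram ℂ f')⁻¹ = LinearMap.toMatrix f f' g * (Matrix.gram ℂ f)⁻¹ *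
      (LinearMap.toMatrix f f' g).conjTranspose := by
  refine Matrix.inv_eq_left_inv ?_
  have h := gram_mul_toMatrix_adjoint f f' g
  -- `G K G* H' = G K H [g*] = G [g*]`, the matrix of `g g* = id`.
  rw [Matrix.mul_assoc, ← h, Matrix.mul_assoc,
    Matrix.nonsing_inv_mul_cancel_left _ _ (isUnit_det_gram f), ← LinearMap.toMatrix_comp,
    comp_adjoint_eq_id hsurj hiso, LinearMap.toMatrix_id]

theorem posSemidef_gram_sub_quotient (f : Module.Basis ι ℂ W) (f' : Module.Basis κ ℂ W')
    (hiso : ∀ u ∈ (LinearMap.ker g)ᗮ, ∀ v ∈ (LinearMap.ker g)ᗮ, ⟪g u, g v⟫_ℂ = ⟪u, v⟫_ℂ) :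
    (Matrix.gram ℂ f - (LinearMap.toMatrix f f' g).conjTranspose * Matrix.gram ℂ f' *
      LinearMap.toMatrix f f' g).PosSemidef := by
  rw [conjTranspose_toMatrix_mul_gram_mul]
  refine .of_dotProduct_mulVec_nonneg
    ((Matrix.isHermitian_gram ℂ f).sub (Matrix.isHermitian_gram ℂ (g ∘ f))) fun x => ?_
  rw [Matrix.sub_mulVec, dotProduct_sub, Matrix.star_dotProduct_gram_mulVec,
    Matrix.star_dotProduct_gram_mulVec, sub_nonneg]
  have h : ∑ i, x i • (g ∘ f) i = g (∑ i, x i • f i) := by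
    simp only [map_sum, map_smul, Function.comp_apply]
  rw [h]
  exact inner_apply_self_le hiso _

end Quotient

/-! ### Positivity of a bundle as a condition on frames. -/

section Bundles

variable (V : Type*) [NormedAddCommGroup V]
  {X : Type*} [TopologicalSpace X] [ChartedSpace V X]
  (F : Type*) [NormedAddCommGroup F]
  (E : X → Type*) [TopologicalSpace (Bundle.TotalSpace F E)]
  [∀ x, NormedAddCommGroup (E x)] [FiberBundle F E]

theorem eventually_chart_symm_mem_baseSet (x : X) :
    ∀ᶠ z in nhds (chartAt V x x), (chartAt V x).symm z ∈ (trivializationAt F E x).baseSet := by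
  have h1 : ContinuousAt (chartAt V x).symm (chartAt V x x) :=
    (chartAt V x).continuousAt_symm (mem_chart_target V x)
  refine h1.eventually_mem ((trivializationAt F E x).open_baseSet.mem_nhds ?_)
  rw [(chartAt V x).left_inv (mem_chart_source V x)]
  exact FiberBundle.mem_baseSet_trivializationAt F E x

variable [NormedSpace ℂ F] [FiniteDimensional ℂ F] [∀ x, InnerProductSpace ℂ (E x)]

theorem gram_isHermitian (x : X) (z : V) : (gram V F E x z).IsHermitian :=
  Matrix.isHermitian_gram ℂ _

variable {V F E} in
theorem IsSmoothMetric.contDiffAt_gram [NormedSpace ℂ V] (h : IsSmoothMetric V F E) (x : X)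
    (i j : Fin (Module.finrank ℂ F)) :
    ContDiffAt ℝ 2 (fun z => gram V F E x z i j) (chartAt V x x) := by
  refine ((h x (Module.finBasis ℂ F i) (Module.finBasis ℂ F j)).contDiffAt ?_).of_le ?_
  · exact Filter.inter_mem ((chartAt V x).open_target.mem_nhds (mem_chart_target V x))
      (eventually_chart_symm_mem_baseSet V F E x)
  · exact WithTop.coe_le_coe.2 (le_top : (2 : ℕ∞) ≤ ⊤)

variable [VectorBundle ℂ F E]

/-- The frame of the fibre at `p` given by the preferred trivialization at `x`. -/
noncomputable def localFrame (x p : X) (hp : p ∈ (trivializationAt F E x).baseSet) :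
    Module.Basis (Fin (Module.finrank ℂ F)) ℂ (E p) :=
  (Module.finBasis ℂ F).map ((trivializationAt F E x).linearEquivAt ℂ p hp).symm

theorem gram_eq_gram_localFrame (x : X) (z : V)
    (hz : (chartAt V x).symm z ∈ (trivializationAt F E x).baseSet) :
    gram V F E x z = Matrix.gram ℂ (localFrame F E x _ hz) := rfl

theorem gram_chartAt (x : X) :
    gram V F E x (chartAt V x x) = Matrix.gram ℂ (frameAt F E x) := by
  ext i j
  -- The base point `(chartAt V x).symm (chartAt V x x)` equals `x` only propositionally, so the
  -- fibre is generalized before rewriting.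
  have h : ∀ p, p = x → ∀ a b : F,
      ⟪(trivializationAt F E x).symm p a, (trivializationAt F E x).symm p b⟫_ℂ =
        ⟪(trivializationAt F E x).symm x a, (trivializationAt F E x).symm x b⟫_ℂ := by
    rintro p rfl a b
    rfl
  exact h _ ((chartAt V x).left_inv (mem_chart_source V x)) _ _

theorem isUnit_det_gram_chartAt (x : X) : IsUnit (gram V F E x (chartAt V x x)).det := by
  rw [gram_chartAt]
  exact isUnit_det_gram _

theorem finrank_fiber (x : X) : Module.finrank ℂ (E x) = Module.finrank ℂ F := by
  rw [Module.finrank_eq_card_basis (frameAt F E x), Fintype.card_fin]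

variable [NormedSpace ℂ V]

/-- The sum over a frame that computes the Bott–Chern form at `x`. -/
noncomputable def frameCurvatureSum (x : X) (ζ : Fin (Module.finrank ℂ F) → V) : ℂ :=
  ∑ a, ∑ b, inverseGramCurvature (gram V F E x) (chartAt V x x) (ζ a) (ζ b) a b

variable {V F E}

theorem bottChernForm_eq_frameCurvatureSum (h : IsSmoothMetric V F E) (x : X)
    (e : OrthonormalBasis (Fin (Module.finrank ℂ F)) ℂ (E x))
    (t : TangentSpace 𝓘(ℂ, V) x ⊗[ℂ] Module.Dual ℂ (E x)) :
    bottChernForm (normalizedCurvature V F E x) e t t =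
      ((1 / (2 * Real.pi) : ℝ) : ℂ) *
        frameCurvatureSum V F E x fun a => contractVec t (frameAt F E x a) := by
  have hH := h.contDiffAt_gram x
  have hy := isUnit_det_gram_chartAt V F E x
  have key := bottChernForm_toLin (T := V) e (frameAt F E x)
    (curvatureForm (chernForm (gram V F E x)) (chartAt V x x)) (Complex.I / (2 * Real.pi))
    (inverseGramCurvatureLin hH hy) (fun v w => by
      rw [← gram_chartAt V F E x, mixed_curvatureForm_mul_inv hH hy]
      rfl) t
  refine key.trans ?_
  have hc : -Complex.I * (Complex.I / (2 * Real.pi)) = ((1 / (2 * Real.pi) : ℝ) : ℂ) := by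
    push_cast
    linear_combination (-1 / (2 * Real.pi) : ℂ) * Complex.I_mul_I
  rw [hc]
  rfl

/-- The constant is `-i * i / 2π = 1 / 2π > 0`, and every family `ζ` is the contraction with the
frame of some tensor, namely `∑ ζ_i ⊗ f_i^*`. -/
theorem isBottChernPositive_iff (h : IsSmoothMetric V F E) :
    IsBottChernPositive V F E ↔ ∀ x ζ, 0 ≤ frameCurvatureSum V F E x ζ := by
  constructor
  · intro hpos x ζ
    have : FiniteDimensional ℂ (E x) := (frameAt F E x).finiteDimensional_of_finite
    let e := (stdOrthonormalBasis ℂ (E x)).reindex (finCongr (finrank_fiber F E x))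
    obtain ⟨t, ht⟩ : ∃ t : TangentSpace 𝓘(ℂ, V) x ⊗[ℂ] Module.Dual ℂ (E x),
        (fun a => contractVec t (frameAt F E x a)) = ζ :=
      ⟨_, funext (contractVec_sum_tmul_coord (T := TangentSpace 𝓘(ℂ, V) x) (frameAt F E x) ζ)⟩
    have h1 := hpos x e t
    rw [bottChernForm_eq_frameCurvatureSum h, ht] at h1
    have h2 := mul_nonneg (Complex.zero_le_real.2 Real.two_pi_pos.le) h1
    rwa [← mul_assoc, ← Complex.ofReal_mul, mul_one_div_cancel Real.two_pi_pos.ne',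
      Complex.ofReal_one, one_mul] at h2
  · intro hsum x e t
    rw [bottChernForm_eq_frameCurvatureSum h]
    exact mul_nonneg (Complex.zero_le_real.2 (one_div_nonneg.2 Real.two_pi_pos.le)) (hsum x _)

end Bundles

/-! ### The matrix of a holomorphic morphism, and the comparison of curvatures. -/

section Morphism

variable {V : Type*} [NormedAddCommGroup V]
  {X : Type*} [TopologicalSpace X] [ChartedSpace V X]
  {FE : Type*} [NormedAddCommGroup FE] [NormedSpace ℂ FE] [FiniteDimensional ℂ FE]
  {E : X → Type*} [TopologicalSpace (Bundle.TotalSpace FE E)]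
  [∀ x, NormedAddCommGroup (E x)] [∀ x, InnerProductSpace ℂ (E x)]
  [FiberBundle FE E]
  {FQ : Type*} [NormedAddCommGroup FQ] [NormedSpace ℂ FQ] [FiniteDimensional ℂ FQ]
  {Q : X → Type*} [TopologicalSpace (Bundle.TotalSpace FQ Q)]
  [∀ x, NormedAddCommGroup (Q x)] [∀ x, InnerProductSpace ℂ (Q x)]
  [FiberBundle FQ Q]

/-- The matrix of a morphism of bundles in the local frames at `x`. -/
noncomputable def morphismMatrix (g : ∀ x, E x →ₗ[ℂ] Q x) (x : X) (z : V) :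
    Matrix (Fin (Module.finrank ℂ FQ)) (Fin (Module.finrank ℂ FE)) ℂ :=
  Matrix.of fun i j => (Module.finBasis ℂ FQ).repr
    (trivializationAt FQ Q x ⟨(chartAt V x).symm z, g _
      ((trivializationAt FE E x).symm ((chartAt V x).symm z) (Module.finBasis ℂ FE j))⟩).2 i

theorem morphismMatrix_eq_toMatrix [VectorBundle ℂ FE E] [VectorBundle ℂ FQ Q]
    (g : ∀ x, E x →ₗ[ℂ] Q x) (x : X) (z : V)
    (hz : (chartAt V x).symm z ∈ (trivializationAt FE E x).baseSet)
    (hz' : (chartAt V x).symm z ∈ (trivializationAt FQ Q x).baseSet) :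
    morphismMatrix g x z = LinearMap.toMatrix (localFrame FE E x _ hz) (localFrame FQ Q x _ hz')
      (g ((chartAt V x).symm z)) := by
  ext i j
  rw [LinearMap.toMatrix_apply]
  rfl

variable [NormedSpace ℂ V] [IsManifold 𝓘(ℂ, V) ω X]

theorem contDiffAt_morphismMatrix {g : ∀ x, E x →ₗ[ℂ] Q x}
    (hg : IsHolomorphicMorphism V FE FQ g) (x : X) (i : Fin (Module.finrank ℂ FQ))
    (j : Fin (Module.finrank ℂ FE)) :
    ContDiffAt ℂ 2 (fun z => morphismMatrix (FE := FE) (FQ := FQ) g x z i j) (chartAt V x x) := by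
  -- A frame section has constant coordinates in its own trivialization, hence is holomorphic; its
  -- image under `g` is then a holomorphic section, whose coordinates are the entries of the matrix.
  have h1 : ContMDiffAt 𝓘(ℂ, V) (𝓘(ℂ, V).prod 𝓘(ℂ, FE)) ω (fun p => Bundle.TotalSpace.mk' FE p
      ((trivializationAt FE E x).symm p (Module.finBasis ℂ FE j))) x := by
    rw [Bundle.contMDiffAt_section]
    refine (contMDiffAt_const (c := Module.finBasis ℂ FE j)).congr_of_eventuallyEq ?_
    filter_upwards [(trivializationAt FE E x).open_baseSet.mem_nhds
      (FiberBundle.mem_baseSet_trivializationAt FE E x)] with p hp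
    rw [(trivializationAt FE E x).apply_mk_symm hp]
  have h2 := (hg.contMDiffAt).comp x h1
  have h3 := (Bundle.contMDiffAt_section (s := fun p => g p
    ((trivializationAt FE E x).symm p (Module.finBasis ℂ FE j))) x).1 h2
  have h4 : ContMDiffAt 𝓘(ℂ, V) 𝓘(ℂ, V) ω (chartAt V x).symm (chartAt V x x) :=
    contMDiffOn_chart_symm.contMDiffAt
      ((chartAt V x).open_target.mem_nhds (mem_chart_target V x))
  have hx := (chartAt V x).left_inv (mem_chart_source V x)
  have h5 := (ContMDiffAt.comp_of_eq (hg := h3) (hf := h4) hx).contDiffAt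
  have h6 := ((Module.finBasis ℂ FQ).coord i).toContinuousLinearMap.contDiff.contDiffAt.comp _ h5
  exact h6.of_le le_top

variable [VectorBundle ℂ FE E] [VectorBundle ℂ FQ Q]

/-- The sum computing the Bott–Chern form of the quotient bundle is nonnegative if those of the
total bundle are. -/
theorem frameCurvatureSum_quotient_nonneg (hE : IsSmoothMetric V FE E)
    {g : ∀ x, E x →ₗ[ℂ] Q x} (hg : IsHolomorphicMorphism V FE FQ g)
    (hsurj : ∀ x, Function.Surjective (g x))
    (hiso : ∀ x, ∀ u ∈ (LinearMap.ker (g x))ᗮ, ∀ v ∈ (LinearMap.ker (g x))ᗮ,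
      ⟪g x u, g x v⟫_ℂ = ⟪u, v⟫_ℂ)
    (x : X) (hpos : ∀ ζ, 0 ≤ frameCurvatureSum V FE E x ζ)
    (ζ : Fin (Module.finrank ℂ FQ) → V) : 0 ≤ frameCurvatureSum V FQ Q x ζ := by
  have hH := hE.contDiffAt_gram x
  have hy := isUnit_det_gram_chartAt V FE E x
  have hmemE := eventually_chart_symm_mem_baseSet V FE E x
  have hmemQ := eventually_chart_symm_mem_baseSet V FQ Q x
  have hfdE : ∀ p, FiniteDimensional ℂ (E p) := fun p =>
    (frameAt FE E p).finiteDimensional_of_finite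
  have hfdQ : ∀ p, FiniteDimensional ℂ (Q p) := fun p =>
    (frameAt FQ Q p).finiteDimensional_of_finite
  have hquot := inverseGramCurvature_quotient hH hy
    (Filter.Eventually.of_forall (gram_isHermitian V FE E x)) (contDiffAt_morphismMatrix hg x)
    (H' := gram V FQ Q x) (by
      filter_upwards [hmemE, hmemQ] with z hz hz'
      rw [gram_eq_gram_localFrame V FE E x z hz, gram_eq_gram_localFrame V FQ Q x z hz',
        morphismMatrix_eq_toMatrix g x z hz hz']
      exact inv_gram_quotient _ _ (hsurj _) (hiso _))
  have hP : (gram V FE E x (chartAt V x x) -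
      (morphismMatrix (FE := FE) (FQ := FQ) g x (chartAt V x x)).conjTranspose *
        gram V FQ Q x (chartAt V x x) *
        morphismMatrix (FE := FE) (FQ := FQ) g x (chartAt V x x)).PosSemidef := by
    have hz := hmemE.self_of_nhds
    have hz' := hmemQ.self_of_nhds
    rw [gram_eq_gram_localFrame V FE E x _ hz, gram_eq_gram_localFrame V FQ Q x _ hz',
      morphismMatrix_eq_toMatrix g x _ hz hz']
    exact posSemidef_gram_sub_quotient _ _ (hiso _)
  rw [frameCurvatureSum]
  simp only [hquot, Matrix.add_apply, Finset.sum_add_distrib]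
  refine add_nonneg ?_ (sum_mul_mul_conjTranspose_nonneg hP fun a => _)
  -- The family for `E` is the pullback of `ζ` along the transpose of `g`, as for the map `T ⊗ Q* →
  -- T ⊗ E*`.
  have h := hpos fun i => ∑ a,
    morphismMatrix (FE := FE) (FQ := FQ) g x (chartAt V x x) a i • ζ a
  exact h.trans_eq (sum_sesquilinear_apply (inverseGramCurvatureLin hH hy) _ ζ)

end Morphism

end BottChern

theorem proposition7p1
    {V : Type*} [NormedAddCommGroup V] [NormedSpace ℂ V] [FiniteDimensional ℂ V]
    {X : Type*} [TopologicalSpace X] [ChartedSpace V X] [IsManifold 𝓘(ℂ, V) ω X]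
    {FS : Type*} [NormedAddCommGroup FS] [NormedSpace ℂ FS] [FiniteDimensional ℂ FS]
    {S : X → Type*} [TopologicalSpace (Bundle.TotalSpace FS S)]
    [∀ x, NormedAddCommGroup (S x)] [∀ x, InnerProductSpace ℂ (S x)]
    [FiberBundle FS S] [VectorBundle ℂ FS S] [ContMDiffVectorBundle ω FS S 𝓘(ℂ, V)]
    {FE : Type*} [NormedAddCommGroup FE] [NormedSpace ℂ FE] [FiniteDimensional ℂ FE]
    {E : X → Type*} [TopologicalSpace (Bundle.TotalSpace FE E)]
    [∀ x, NormedAddCommGroup (E x)] [∀ x, InnerProductSpace ℂ (E x)]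
    [FiberBundle FE E] [VectorBundle ℂ FE E] [ContMDiffVectorBundle ω FE E 𝓘(ℂ, V)]
    {FQ : Type*} [NormedAddCommGroup FQ] [NormedSpace ℂ FQ] [FiniteDimensional ℂ FQ]
    {Q : X → Type*} [TopologicalSpace (Bundle.TotalSpace FQ Q)]
    [∀ x, NormedAddCommGroup (Q x)] [∀ x, InnerProductSpace ℂ (Q x)]
    [FiberBundle FQ Q] [VectorBundle ℂ FQ Q] [ContMDiffVectorBundle ω FQ Q 𝓘(ℂ, V)]
    (hS : BottChern.IsSmoothMetric V FS S)
    (hE : BottChern.IsSmoothMetric V FE E)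
    (hQ : BottChern.IsSmoothMetric V FQ Q)
    (j : ∀ x, S x →ₗ[ℂ] E x) (g : ∀ x, E x →ₗ[ℂ] Q x)
    (hseq : BottChern.IsHermitianShortExact V FS FE FQ j g)
    (hpos : BottChern.IsBottChernPositive V FE E) :
    BottChern.IsBottChernPositive V FQ Q := by
  refine (BottChern.isBottChernPositive_iff hQ).2 fun x =>
    BottChern.frameCurvatureSum_quotient_nonneg hE hseq.holomorphic_g hseq.surjective
      hseq.metric_quotient x ((BottChern.isBottChernPositive_iff hE).1 hpos x)
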